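/- Let $\Gamma_1=\langle \mu,y \mid \mu W=Wy\rangle$ with $W=y^{-1}\mu y\mu^{-1}$ be the group of the figure-eight knot, with meridian $\mu$ and longitude $\lambda=WW^{*}$, where $W^{*}=\mu^{-1}y\mu y^{-1}$. For a positive integer $n$ let $\Gamma_2^n=\langle a,m \mid a(am)^n=(am)^na\rangle$ be the group of the $(2,2n)$-torus link, and let $l=(am)^nm^{-n}$ and $\mathcal L=(am)^na^{-n}$ (these are the peripheral elements homologous to $a^n$ and to $m^n$, respectively). Let $N_n$ be the union of the two exteriors along a torus, glued so that $l=\mu^4\lambda$ and $m=\mu^3\lambda$; its group is the amalgamated product $\Gamma_n=\pi_1(N_n)=\Gamma_1 *_{H}\Gamma_2^n$, where $H\cong\mathbb Z^2$ is embedded as $\langle \mu^4\lambda,\mu^3\lambda\rangle$ in $\Gamma_1$ and correspondingly as $\langle l,m\rangle$ in $\Gamma_2^n$. The peripheral subgroup of $N_n$ is $\pi_1(\partial N_n)=\langle \mathcal L,a\rangle\subset\Gamma_n$. Let $X(\Gamma_n)$ be the variety of characters of homomorphisms $\Gamma_n\to \mathrm{SL}_2(\mathbb C)$, and for $\gamma\in\Gamma_n$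 let $I_\gamma(\chi)=\chi(\gamma)$; the ring of regular functions on $X(\Gamma_n)$ is the $\mathbb C$-algebra generated by all $I_\gamma$. An ideal point of an irreducible algebraic curve $X\subset X(\Gamma_n)$ is a point of the smooth projective model $\widetilde X$ of $X$ that does not lie over a point of $X$. We say that $\xi\in\mathbb C^\times$ *appears* at the ideal point $x$, with detected slope $\{\alpha,\alpha^{-1}\}$, if $\alpha$ is a primitive element of $\pi_1(\partial N_n)$, some $I_\gamma$ with $\gamma\in\pi_1(\partial N_n)$ has a pole at $x$, and $I_\alpha$ is finite at $x$ with value $\xi+\xi^{-1}$. **Theorem 4.1.** Let $n$ be a positive integer and let $\xi\in\mathbb C$ be any $n$-th root of unity (not necessarily primitive). Then there are a sequence of irreducible representations $\rho_i\colon\Gamma_n\to \mathrm{SL}_2(\mathbb C)$ and numbers $A_i,B_i\in\mathbb C^\times$ such that $$\rho_i(\mathcal L)=\begin{pmatrix}B_i&0\\0&B_i^{-1}\end{pmatrix},\qquad \rho_i(a)=\begin{pmatrix}A_i&0\\0&A_i^{-1}\end{pmatrix},\qquad B_i\to0,\quad A_i\to\xi .$$ Moreover, $\xi$ appears at an ideal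 point $x$ of some irreducible algebraic curve in $X(\Gamma_n)$, with detected slope $\{a,a^{-1}\}$. -/

import Mathlib

open Filter Topology

noncomputable section

/-! ### Representations in `SL₂(ℂ)` and characters -/

/-- The group `SL₂(ℂ)`. -/
abbrev SL2C : Type := Matrix.SpecialLinearGroup (Fin 2) ℂ

/-- The linear representation on `ℂ²` attached to a homomorphism `G → SL₂(ℂ)`. -/
def linearRep {G : Type} [Group G] (ρ : G →* SL2C) : Representation ℂ G (Fin 2 → ℂ) where
  toFun g := (ρ g : Matrix (Fin 2) (Fin 2) ℂ).mulVecLin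
  map_one' := by simp [Module.End.one_eq_id]
  map_mul' g h := by simp [Matrix.mulVecLin_mul, Module.End.mul_eq_comp]

/-- A homomorphism `G → SL₂(ℂ)` is irreducible if the representation on `ℂ²` is. -/
def IsIrreducibleRep {G : Type} [Group G] (ρ : G →* SL2C) : Prop :=
  (linearRep ρ).IsIrreducible

/-- The character of a homomorphism `G → SL₂(ℂ)`. -/
def sl2Character {G : Type} [Group G] (ρ : G →* SL2C) : G → ℂ :=
  fun g => (ρ g : Matrix (Fin 2) (Fin 2) ℂ).trace

/-- `X(G)`: the set of characters of homomorphisms `G → SL₂(ℂ)`. -/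
def CharacterVariety (G : Type) [Group G] : Type :=
  {χ : G → ℂ // ∃ ρ : G →* SL2C, sl2Character ρ = χ}

/-- The function `I_g(χ) = χ(g)` on `X(G)`. -/
def traceFunction {G : Type} [Group G] (g : G) : CharacterVariety G → ℂ :=
  fun χ => χ.1 g

/-- The ring of regular functions on `X(G)`: the `ℂ`-algebra of functions generated by all `I_g`.
For finitely generated `G` it is generated by finitely many `I_g`, and these are the coordinates
of the usual embedding of `X(G)` as a closed algebraic set in some `ℂ^m`. -/
def regularFunctions (G : Type) [Group G] : Subalgebra ℂ (CharacterVariety G → ℂ) :=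
  Algebra.adjoin ℂ (Set.range traceFunction)

/-- The restriction of functions on `X(G)` to a subset. -/
def restrictTo {G : Type} [Group G] (X : Set (CharacterVariety G)) :
    (CharacterVariety G → ℂ) →ₐ[ℂ] (X → ℂ) where
  toFun f := fun χ => f χ
  map_one' := rfl
  map_mul' _ _ := rfl
  map_zero' := rfl
  map_add' _ _ := rfl
  commutes' _ := rfl

/-- The coordinate ring `ℂ[X]` of a subset `X` of `X(G)`: restrictions of regular functions. -/
def coordinateRing {G : Type} [Group G] (X : Set (CharacterVariety G)) :
    Subalgebra ℂ (X → ℂ) :=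
  (regularFunctions G).map (restrictTo X)

/-- An irreducible algebraic curve in `X(G)`: a Zariski closed subset whose coordinate ring is a
domain of transcendence degree one over `ℂ`. -/
structure CharacterCurve (G : Type) [Group G] where
  carrier : Set (CharacterVariety G)
  isZariskiClosed : ∃ S : Set (CharacterVariety G → ℂ),
    S ⊆ regularFunctions G ∧ carrier = {χ | ∀ f ∈ S, f χ = 0}
  isDomain : IsDomain (coordinateRing carrier)
  trdeg_eq_one : Algebra.trdeg ℂ (coordinateRing carrier) = 1

attribute [instance] CharacterCurve.isDomain

namespace CharacterCurve

variable {G : Type} [Group G]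

/-- The function field `ℂ(X)`. -/
abbrev FunctionField (X : CharacterCurve G) : Type := FractionRing (coordinateRing X.carrier)

/-- The function `I_g` as a regular function on the curve. -/
def traceElt (X : CharacterCurve G) (g : G) : coordinateRing X.carrier :=
  ⟨restrictTo X.carrier (traceFunction g), traceFunction g,
    Algebra.subset_adjoin (Set.mem_range_self g), rfl⟩

/-- The rational function on the curve (hence on its smooth projective model) induced by `I_g`. -/
def I (X : CharacterCurve G) (g : G) : X.FunctionField :=
  algebraMap (coordinateRing X.carrier) X.FunctionField (X.traceElt g)

/-- An ideal point of the curve `X` (for finitely generated `G`). The points of the smooth projective model of `X` are the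
valuation rings of `ℂ(X)` that contain `ℂ` and are not all of `ℂ(X)`. The points that lie over a
point of the affine curve `X` are those whose valuation ring contains `ℂ[X]`; the ideal points are
the others. -/
structure IdealPoint (X : CharacterCurve G) where
  valuationRing : ValuationSubring X.FunctionField
  constants_mem : ∀ c : ℂ, algebraMap ℂ X.FunctionField c ∈ valuationRing
  exists_regular_notMem : ∃ f : coordinateRing X.carrier,
    algebraMap (coordinateRing X.carrier) X.FunctionField f ∉ valuationRing

namespace IdealPoint

variable {X : CharacterCurve G}

/-- The rational function `f` has a pole at `x`. -/
def HasPole (x : X.IdealPoint) (f : X.FunctionField) : Prop := f ∉ x.valuationRing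

/-- The rational function `f` is finite at `x`, with value `c`: the difference `f - c` lies in the
maximal ideal of the valuation ring. -/
def HasValue (x : X.IdealPoint) (f : X.FunctionField) (c : ℂ) : Prop :=
  x.valuationRing.valuation (f - algebraMap ℂ X.FunctionField c) < 1

/-- Let `P` be a peripheral subgroup (free abelian of rank two). The ideal point `x` detects the
slope `{α, α⁻¹}`, and `ξ` is the root of unity that appears there: `α` is a primitive element
of `P` (a member of a basis), some `I_γ` with `γ ∈ P` has a pole at `x`, and `I_α` is finite
at `x` with value `ξ + ξ⁻¹`. -/
def AppearsAtSlope (x : X.IdealPoint) (P : Subgroup G) (α : G) (ξ : ℂ) : Prop :=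
  (∃ β : G, Subgroup.closure {α, β} = P) ∧
    (∃ γ ∈ P, x.HasPole (X.I γ)) ∧ x.HasValue (X.I α) (ξ + ξ⁻¹)

end IdealPoint

end CharacterCurve

/-! ### The group of the figure-eight knot -/

namespace FigEight

/-- The word `W = y⁻¹ μ y μ⁻¹`. -/
def W {G : Type} [Group G] (μ y : G) : G := y⁻¹ * μ * y * μ⁻¹

/-- The word `W* = μ⁻¹ y μ y⁻¹`. -/
def Wstar {G : Type} [Group G] (μ y : G) : G := μ⁻¹ * y * μ * y⁻¹

/-- The relator of `μ W = W y`; `false` stands for `μ` and `true` for `y`. -/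
def relator : FreeGroup Bool :=
  let μ := FreeGroup.of false
  let y := FreeGroup.of true
  (μ * W μ y) * (W μ y * y)⁻¹

/-- The knot group `Γ₁ = ⟨ μ, y ∣ μ W = W y ⟩`. -/
abbrev Γ : Type := PresentedGroup ({relator} : Set (FreeGroup Bool))

/-- The meridian. -/
def μ : Γ := PresentedGroup.of false

/-- The other generator. -/
def y : Γ := PresentedGroup.of true

/-- The longitude `λ = W W*`. -/
def longitude : Γ := W μ y * Wstar μ y

theorem relation : μ * W μ y = W μ y * y := by
  have h : PresentedGroup.mk ({relator} : Set (FreeGroup Bool)) relator = 1 :=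
    PresentedGroup.one_of_mem rfl
  exact mul_inv_eq_one.mp h

theorem commute_meridian_longitude : Commute μ longitude := by
  have h := relation
  simp only [W] at h
  have h2 : Wstar μ y * μ = y * Wstar μ y := by
    have e : Wstar μ y * μ * (y * Wstar μ y)⁻¹ = (μ⁻¹ * y) *
        ((μ * (y⁻¹ * μ * y * μ⁻¹)) * ((y⁻¹ * μ * y * μ⁻¹) * y)⁻¹) * (μ⁻¹ * y)⁻¹ := by
      simp only [Wstar]; group
    rw [h, mul_inv_cancel, mul_one, mul_inv_cancel] at e
    exact mul_inv_eq_one.mp e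
  show μ * (W μ y * Wstar μ y) = (W μ y * Wstar μ y) * μ
  rw [← mul_assoc, relation, mul_assoc, mul_assoc, h2]

end FigEight

/-! ### The group of the `(2, 2n)`-torus link -/

namespace TorusLink

/-- The relator of `a (a m)ⁿ = (a m)ⁿ a`; `false` stands for `a` and `true` for `m`. -/
def relator (n : ℕ) : FreeGroup Bool :=
  let a := FreeGroup.of false
  let m := FreeGroup.of true
  (a * (a * m) ^ n) * ((a * m) ^ n * a)⁻¹

/-- The link group `Γ₂ⁿ = ⟨ a, m ∣ a (a m)ⁿ = (a m)ⁿ a ⟩`. -/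
abbrev Γ (n : ℕ) : Type := PresentedGroup ({relator n} : Set (FreeGroup Bool))

/-- The meridian of the component that stays in the boundary after gluing. -/
def a (n : ℕ) : Γ n := PresentedGroup.of false

/-- The meridian of the component along which the knot exterior is glued. -/
def m (n : ℕ) : Γ n := PresentedGroup.of true

/-- The element `l` of the peripheral subgroup `⟨m, (a m)ⁿ⟩` that is homologous to `aⁿ`. -/
def l (n : ℕ) : Γ n := (a n * m n) ^ n * (m n ^ n)⁻¹

/-- The element `𝓛` of the peripheral subgroup `⟨a, (a m)ⁿ⟩` that is homologous to `mⁿ`. -/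
def L (n : ℕ) : Γ n := (a n * m n) ^ n * (a n ^ n)⁻¹

theorem commute_a (n : ℕ) : Commute (a n) ((a n * m n) ^ n) := by
  have h : PresentedGroup.mk ({relator n} : Set (FreeGroup Bool)) (relator n) = 1 :=
    PresentedGroup.one_of_mem rfl
  exact mul_inv_eq_one.mp h

theorem commute_m (n : ℕ) : Commute (m n) ((a n * m n) ^ n) := by
  have h1 : Commute (a n * m n) ((a n * m n) ^ n) := (Commute.refl _).pow_right n
  have h2 := (commute_a n).inv_left.mul_left h1
  rwa [inv_mul_cancel_left] at h2

theorem commute_l_m (n : ℕ) : Commute (l n) (m n) :=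
  ((commute_m n).symm).mul_left (((Commute.refl (m n)).pow_left n).inv_left)

theorem commute_L_a (n : ℕ) : Commute (L n) (a n) :=
  ((commute_a n).symm).mul_left (((Commute.refl (a n)).pow_left n).inv_left)

theorem l_homologous (n : ℕ) :
    Abelianization.of (l n) = Abelianization.of (a n ^ n) := by
  simp [l, mul_pow]

theorem L_homologous (n : ℕ) :
    Abelianization.of (L n) = Abelianization.of (m n ^ n) := by
  simp [L, mul_pow]

end TorusLink

/-! ### The amalgamated product -/

namespace GluedManifold

/-- The peripheral subgroup `H ≅ ℤ²` of the gluing torus, written multiplicatively. -/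
abbrev H : Type := Multiplicative ℤ × Multiplicative ℤ

/-- The homomorphism from `H` that sends the two basis elements to the commuting `u`, `v`. -/
def fromH {G : Type} [Group G] (u v : G) (h : Commute u v) : H →* G :=
  (zpowersHom G u).noncommCoprod (zpowersHom G v) fun i j => by
    simpa [zpowersHom_apply] using (h.zpow_zpow _ _)

/-- The two factors: `Γ₁` for `false` and `Γ₂ⁿ` for `true`. -/
abbrev Factor (n : ℕ) : Bool → Type
  | false => FigEight.Γ
  | true => TorusLink.Γ n

instance factorGroup (n : ℕ) : ∀ i, Group (Factor n i)
  | false => inferInstanceAs (Group FigEight.Γ)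
  | true => inferInstanceAs (Group (TorusLink.Γ n))

theorem commute_glue :
    Commute (FigEight.μ ^ 4 * FigEight.longitude) (FigEight.μ ^ 3 * FigEight.longitude) := by
  have h := FigEight.commute_meridian_longitude
  exact (((Commute.refl _).pow_pow 4 3).mul_right (h.pow_left 4)).mul_left
    ((h.symm.pow_right 3).mul_right (Commute.refl _))

/-- The inclusions of the gluing torus: the first basis element goes to `μ⁴λ` and to `l`, the
second one to `μ³λ` and to `m`. -/
def glue (n : ℕ) : ∀ i, H →* Factor n i
  | false => fromH (FigEight.μ ^ 4 * FigEight.longitude) (FigEight.μ ^ 3 * FigEight.longitude)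
      commute_glue
  | true => fromH (TorusLink.l n) (TorusLink.m n) (TorusLink.commute_l_m n)

/-- `Γₙ = π₁(Nₙ) = Γ₁ *_H Γ₂ⁿ`, the free product with amalgamation in which `l = μ⁴λ` and
`m = μ³λ`. -/
abbrev Γ (n : ℕ) : Type := Monoid.PushoutI (glue n)

/-- The image of `a` in `Γₙ`. -/
def a (n : ℕ) : Γ n := Monoid.PushoutI.of (φ := glue n) true (TorusLink.a n)

/-- The image of `𝓛` in `Γₙ`. -/
def L (n : ℕ) : Γ n := Monoid.PushoutI.of (φ := glue n) true (TorusLink.L n)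

/-- The peripheral subgroup `π₁(∂Nₙ) = ⟨𝓛, a⟩`. -/
def peripheral (n : ℕ) : Subgroup (Γ n) := Subgroup.closure {L n, a n}

end GluedManifold

end

/-! ### A family of representations over a domain -/

/-! Representations of `Γₙ` are built to be non-abelian on the figure-eight group and diagonal on
the torus link group. Let the meridian `μ` have eigenvalue `M = t⁻¹` and `λ` eigenvalue `Λ`. Once
`a` and `m` commute, `l` acts as `aⁿ` and `𝓛` as `mⁿ`, so the gluing asks only for an eigenvalue `α`
of `a` with `αⁿ = M⁴Λ`; then `m` has eigenvalue `M³Λ = tαⁿ`, and `𝓛` has `(tαⁿ)ⁿ`.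

The figure-eight knot has boundary slope 4: on one branch of its curve of characters `M⁴Λ → 1` as `t
→ 0`. There `αⁿ → 1`, any `n`-th root of unity `ξ` can be chosen as the limit of `α`, and `(tαⁿ)ⁿ →
0`. The branch is explicit: `s(M - t) = t⁴τ`, where `w = τ⁻¹` solves a monic quadratic over `ℤ[t]`
whose roots at `t = 0` are 0 and 1; the root 1 is taken (`rileyPoly_eq_zero`,
`longitudeEigenvalue_eq`).

This algebra (`exists_rep`) is used twice. Over `ℂ`, with `t = 1/(i + 2)` and continuous choices of
roots, it gives the sequence. Over an algebraically closed field `F` of transcendence degree one,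
with `t` in the maximal ideal of a valuation ring `V ⊇ ℂ`, it gives a generic representation over a
finitely generated algebra `A ⊆ F`. The Zariski closure of the characters of its specializations is
a curve whose function field embeds in `F` (`exists_characterCurve`), and `V` restricts to the ideal
point. -/

/-- The diagonal embedding of the units of `R` into `SL₂(R)`. -/
def diagSL (R : Type) [CommRing R] : Rˣ →* Matrix.SpecialLinearGroup (Fin 2) R where
  toFun u := ⟨!![(u : R), 0; 0, ((u⁻¹ : Rˣ) : R)], by simp [Matrix.det_fin_two]⟩
  map_one' := by ext i j; fin_cases i <;> fin_cases j <;> simp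
  map_mul' u v := by
    apply Subtype.ext
    change (!![((u * v : Rˣ) : R), 0; 0, (((u * v)⁻¹ : Rˣ) : R)] : Matrix (Fin 2) (Fin 2) R) =
      !![(u : R), 0; 0, ((u⁻¹ : Rˣ) : R)] * !![(v : R), 0; 0, ((v⁻¹ : Rˣ) : R)]
    rw [Matrix.mul_fin_two]
    simp [mul_comm]

theorem coe_diagSL {R : Type} [CommRing R] (u : Rˣ) :
    (diagSL R u : Matrix (Fin 2) (Fin 2) R) = !![(u : R), 0; 0, ((u⁻¹ : Rˣ) : R)] := rfl

/-- A matrix of determinant one that commutes with a diagonal matrix with distinct entries is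
diagonal. -/
theorem exists_eq_diagSL_of_commute {R : Type} [CommRing R] [IsDomain R] (u : Rˣ)
    (hu : (u : R) ≠ ((u⁻¹ : Rˣ) : R)) (g : Matrix.SpecialLinearGroup (Fin 2) R)
    (h : Commute (diagSL R u) g) : ∃ v : Rˣ, g = diagSL R v ∧ (v : R) = g 0 0 := by
  have hm : (diagSL R u : Matrix (Fin 2) (Fin 2) R) * (g : Matrix (Fin 2) (Fin 2) R) =
      (g : Matrix (Fin 2) (Fin 2) R) * (diagSL R u : Matrix (Fin 2) (Fin 2) R) := by
    have := congrArg (fun x : Matrix.SpecialLinearGroup (Fin 2) R => (x : Matrix (Fin 2) (Fin 2) R)) h.eq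
    simpa using this
  have hd := g.det_coe
  rw [Matrix.det_fin_two] at hd
  have hu' := sub_ne_zero.mpr hu
  have h01 : g 0 1 = 0 := by
    have := congrFun (congrFun hm 0) 1
    simp only [coe_diagSL, Matrix.mul_apply, Fin.sum_univ_two] at this
    simp at this
    exact (mul_eq_zero.mp (show ((u : R) - ((u⁻¹ : Rˣ) : R)) * g 0 1 = 0 by
      linear_combination this)).resolve_left hu'
  have h10 : g 1 0 = 0 := by
    have := congrFun (congrFun hm 1) 0
    simp only [coe_diagSL, Matrix.mul_apply, Fin.sum_univ_two] at this
    simp at this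
    exact (mul_eq_zero.mp (show ((u : R) - ((u⁻¹ : Rˣ) : R)) * g 1 0 = 0 by
      linear_combination -this)).resolve_left hu'
  rw [h01, h10, mul_zero, sub_zero] at hd
  refine ⟨⟨g 0 0, g 1 1, hd, by rw [mul_comm, hd]⟩, ?_, rfl⟩
  ext i j
  fin_cases i <;> fin_cases j <;> simp [coe_diagSL, h01, h10]

/-- The image of the second generator of the figure-eight knot group. -/
def conjMeridian {R : Type} [CommRing R] (t M s : R) : Matrix.SpecialLinearGroup (Fin 2) R :=
  ⟨!![M + t - s, 1; (M + t - s) * s - 1, s], by simp [Matrix.det_fin_two]⟩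

theorem coe_conjMeridian {R : Type} [CommRing R] (t M s : R) :
    (conjMeridian t M s : Matrix (Fin 2) (Fin 2) R) =
      !![M + t - s, 1; (M + t - s) * s - 1, s] := rfl

/-- The condition on the parameter `s` under which the meridian with eigenvalues `M`, `t = M⁻¹` and
`conjMeridian t M s` satisfy the relation of the figure-eight knot group. -/
def rileyPoly {R : Type} [CommRing R] (t M s : R) : R :=
  (M + t - s) * s * (M - t) ^ 2 - s * (M - t) - t ^ 2

/-- The upper left entry of the image of the longitude of the figure-eight knot. -/
def longitudeEigenvalue {R : Type} [CommRing R] (t M s : R) : R :=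
  (1 + ((M + t - s) * s - 1) * (1 - t ^ 2)) ^ 2 +
    ((M + t - s) * s - 1) * s ^ 2 * (M ^ 2 - 1) ^ 2

theorem relation_of_rileyPoly {R : Type} [CommRing R] (u : Rˣ) (s : R)
    (h : rileyPoly ((u⁻¹ : Rˣ) : R) u s = 0) :
    diagSL R u * FigEight.W (diagSL R u) (conjMeridian ((u⁻¹ : Rˣ) : R) u s) =
      FigEight.W (diagSL R u) (conjMeridian ((u⁻¹ : Rˣ) : R) u s) *
        conjMeridian ((u⁻¹ : Rˣ) : R) u s := by
  have hu : ((u⁻¹ : Rˣ) : R) * (u : R) = 1 := u.inv_mul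
  unfold rileyPoly at h
  apply Subtype.ext
  simp only [FigEight.W, Matrix.SpecialLinearGroup.coe_mul, Matrix.SpecialLinearGroup.coe_inv, coe_diagSL,
    coe_conjMeridian, Matrix.adjugate_fin_two_of, Matrix.mul_fin_two]
  -- With `t` and `M` as free variables, each matrix entry is a polynomial identity modulo `tM = 1`
  -- and the Riley relation.
  generalize ((u⁻¹ : Rˣ) : R) = t at *
  generalize (u : R) = M at *
  ext i j
  fin_cases i <;> fin_cases j <;>
    simp only [Fin.zero_eta, Fin.mk_one, Fin.isValue, Matrix.of_apply, Matrix.cons_val_zero,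
      Matrix.cons_val_one, Matrix.cons_val_fin_one] <;>
    grind

theorem longitude_apply {R : Type} [CommRing R] (u : Rˣ) (s : R) :
    (FigEight.W (diagSL R u) (conjMeridian ((u⁻¹ : Rˣ) : R) u s) *
      FigEight.Wstar (diagSL R u) (conjMeridian ((u⁻¹ : Rˣ) : R) u s)) 0 0 =
      longitudeEigenvalue ((u⁻¹ : Rˣ) : R) u s := by
  have hu : ((u⁻¹ : Rˣ) : R) * (u : R) = 1 := u.inv_mul
  simp only [FigEight.W, FigEight.Wstar, Matrix.SpecialLinearGroup.coe_mul, Matrix.SpecialLinearGroup.coe_inv,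
    coe_diagSL, coe_conjMeridian, Matrix.adjugate_fin_two_of, Matrix.mul_fin_two,
    longitudeEigenvalue, Matrix.of_apply, Matrix.cons_val_zero]
  generalize ((u⁻¹ : Rˣ) : R) = t at *
  generalize (u : R) = M at *
  grind

/-- The representation of the figure-eight knot group with diagonal peripheral subgroup. -/
theorem exists_figEight_rep {R : Type} [CommRing R] [IsDomain R] (u : Rˣ)
    (hu : (u : R) ≠ ((u⁻¹ : Rˣ) : R)) (s : R) (h : rileyPoly ((u⁻¹ : Rˣ) : R) u s = 0) :
    ∃ (ρ : FigEight.Γ →* Matrix.SpecialLinearGroup (Fin 2) R) (v : Rˣ),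
      ρ FigEight.μ = diagSL R u ∧ ρ FigEight.y = conjMeridian ((u⁻¹ : Rˣ) : R) u s ∧
      ρ FigEight.longitude = diagSL R v ∧
      (v : R) = longitudeEigenvalue ((u⁻¹ : Rˣ) : R) u s := by
  let f : Bool → Matrix.SpecialLinearGroup (Fin 2) R :=
    fun b => bif b then conjMeridian ((u⁻¹ : Rˣ) : R) u s else diagSL R u
  have hf : ∀ r ∈ ({FigEight.relator} : Set (FreeGroup Bool)), FreeGroup.lift f r = 1 := by
    rintro r rfl
    have := relation_of_rileyPoly u s h
    simp only [FigEight.relator, FigEight.W, map_mul, map_inv, FreeGroup.lift_apply_of, f,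
      cond_true, cond_false] at this ⊢
    rw [mul_inv_eq_one]
    exact this
  have hμ : PresentedGroup.toGroup hf FigEight.μ = diagSL R u := PresentedGroup.toGroup.of hf
  have hy : PresentedGroup.toGroup hf FigEight.y = conjMeridian ((u⁻¹ : Rˣ) : R) u s :=
    PresentedGroup.toGroup.of hf
  have hl : PresentedGroup.toGroup hf FigEight.longitude =
      FigEight.W (diagSL R u) (conjMeridian ((u⁻¹ : Rˣ) : R) u s) *
      FigEight.Wstar (diagSL R u) (conjMeridian ((u⁻¹ : Rˣ) : R) u s) := by
    simp only [FigEight.longitude, FigEight.W, FigEight.Wstar, map_mul, map_inv, hμ, hy]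
  -- Commuting with a diagonal matrix with distinct entries forces the longitude to be diagonal, so
  -- its upper left entry determines it.
  have hc : Commute (diagSL R u) (PresentedGroup.toGroup hf FigEight.longitude) := by
    have := FigEight.commute_meridian_longitude.map (PresentedGroup.toGroup hf)
    rwa [hμ] at this
  obtain ⟨v, hv, hv'⟩ := exists_eq_diagSL_of_commute u hu _ hc
  exact ⟨_, v, hμ, hy, hv, by rw [hv', hl, longitude_apply]⟩

/-- The representation of the torus link group by commuting elements. -/
theorem exists_torusLink_rep {G : Type} [Group G] (n : ℕ) (x z : G) (h : Commute x z) :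
    ∃ ρ : TorusLink.Γ n →* G, ρ (TorusLink.a n) = x ∧ ρ (TorusLink.m n) = z ∧
      ρ (TorusLink.l n) = x ^ n ∧ ρ (TorusLink.L n) = z ^ n := by
  let f : Bool → G := fun b => bif b then z else x
  have hf : ∀ r ∈ ({TorusLink.relator n} : Set (FreeGroup Bool)), FreeGroup.lift f r = 1 := by
    rintro r rfl
    simp only [TorusLink.relator, map_mul, map_inv, map_pow, FreeGroup.lift_apply_of, f,
      cond_true, cond_false]
    rw [mul_inv_eq_one]
    exact ((Commute.refl x).mul_right h).pow_right n
  have ha : PresentedGroup.toGroup hf (TorusLink.a n) = x := PresentedGroup.toGroup.of hf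
  have hm : PresentedGroup.toGroup hf (TorusLink.m n) = z := PresentedGroup.toGroup.of hf
  refine ⟨_, ha, hm, ?_, ?_⟩
  · simp only [TorusLink.l, map_mul, map_inv, map_pow, ha, hm]
    rw [h.mul_pow, mul_inv_cancel_right]
  · simp only [TorusLink.L, map_mul, map_inv, map_pow, ha, hm]
    rw [h.eq, h.symm.mul_pow, mul_inv_cancel_right]

/-! ### Gluing representations of the two factors -/

theorem map_fromH {G K : Type} [Group G] [Group K] (f : G →* K) (u v : G) (h : Commute u v) :
    f.comp (GluedManifold.fromH u v h) = GluedManifold.fromH (f u) (f v) (h.map f) := by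
  ext x
  simp [GluedManifold.fromH]

/-- Homomorphisms from `Γₙ` are given by homomorphisms of the factors that agree on the torus. -/
theorem exists_glued_rep {K : Type} [Group K] (n : ℕ) (ρ₁ : FigEight.Γ →* K)
    (ρ₂ : TorusLink.Γ n →* K)
    (hl : ρ₁ (FigEight.μ ^ 4 * FigEight.longitude) = ρ₂ (TorusLink.l n))
    (hm : ρ₁ (FigEight.μ ^ 3 * FigEight.longitude) = ρ₂ (TorusLink.m n)) :
    ∃ ρ : GluedManifold.Γ n →* K,
      (∀ g, ρ (Monoid.PushoutI.of (φ := GluedManifold.glue n) false g) = ρ₁ g) ∧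
      (∀ g, ρ (Monoid.PushoutI.of (φ := GluedManifold.glue n) true g) = ρ₂ g) := by
  let f : ∀ i, GluedManifold.Factor n i →* K
    | false => ρ₁
    | true => ρ₂
  refine ⟨Monoid.PushoutI.lift f (ρ₂.comp (GluedManifold.glue n true)) ?_, ?_, ?_⟩
  · rintro (_ | _)
    · change ρ₁.comp (GluedManifold.fromH _ _ GluedManifold.commute_glue) =
        ρ₂.comp (GluedManifold.fromH _ _ (TorusLink.commute_l_m n))
      rw [map_fromH, map_fromH]
      congr 1
    · rfl
  · exact fun g => Monoid.PushoutI.lift_of f _ _ (i := false) g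
  · exact fun g => Monoid.PushoutI.lift_of f _ _ (i := true) g

/-- The representations of `Γₙ` that are non-abelian on the figure-eight factor and diagonal on the
torus link factor. -/
theorem exists_rep {R : Type} [CommRing R] [IsDomain R] {n : ℕ} (hn : n ≠ 0) (u : Rˣ)
    (hu : (u : R) ≠ ((u⁻¹ : Rˣ) : R)) (s α : R) (h : rileyPoly ((u⁻¹ : Rˣ) : R) u s = 0)
    (hα : α ^ n = (u : R) ^ 4 * longitudeEigenvalue ((u⁻¹ : Rˣ) : R) u s) :
    ∃ (ρ : GluedManifold.Γ n →* Matrix.SpecialLinearGroup (Fin 2) R) (x z : Rˣ),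
      (∃ g, ρ g = diagSL R u) ∧ (∃ g, ρ g = conjMeridian ((u⁻¹ : Rˣ) : R) u s) ∧
      ρ (GluedManifold.a n) = diagSL R x ∧ ρ (GluedManifold.L n) = diagSL R z ∧
      (x : R) = α ∧ (z : R) = (((u⁻¹ : Rˣ) : R) * α ^ n) ^ n := by
  obtain ⟨ρ₁, v, hμ, hy, hv, hv'⟩ := exists_figEight_rep u hu s h
  rw [← hv'] at hα
  have hunit : IsUnit α := by
    rw [← isUnit_pow_iff hn, hα]
    exact (u.isUnit.pow 4).mul v.isUnit
  obtain ⟨x, rfl⟩ := hunit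
  have hα' : x ^ n = u ^ 4 * v := by ext; simpa using hα
  have hc : Commute (diagSL R x) (diagSL R (u ^ 3 * v)) := (Commute.all x _).map (diagSL R)
  obtain ⟨ρ₂, ha, hm, hl, hL⟩ := exists_torusLink_rep n _ _ hc
  obtain ⟨ρ, h1, h2⟩ := exists_glued_rep n ρ₁ ρ₂
    (by simp only [map_mul, map_pow, hμ, hv, hl]; rw [← map_pow, ← map_pow, hα', map_mul])
    (by simp only [map_mul, map_pow, hμ, hv, hm])
  refine ⟨ρ, x, (u ^ 3 * v) ^ n, ⟨_, (h1 _).trans hμ⟩, ⟨_, (h1 _).trans hy⟩,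
    (h2 _).trans ha, ((h2 _).trans hL).trans (map_pow _ _ _).symm, rfl, ?_⟩
  -- Written this way, the eigenvalue of `m` visibly vanishes as `t = u⁻¹ → 0` with `x` bounded.
  have : u ^ 3 * v = u⁻¹ * x ^ n := by
    rw [hα', ← mul_assoc]
    group
  rw [this]
  push_cast
  rfl

/-! ### Parametrization near the ideal point -/

/-- In `σ = s(M - t)` the Riley condition is the quadratic `σ² - (M² - t² - 1)σ + t² = 0`. For large
`M` its small root is about `t²/M² = t⁴`; the scaling `σ = t⁴τ` makes that root regular at `t = 0`.
-/
theorem rileyPoly_eq_zero {R : Type} [CommRing R] {t M s τ : R} (h : t * M = 1)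
    (hs : s * (M - t) = t ^ 4 * τ) (hτ : t ^ 6 * τ ^ 2 - (1 - t ^ 2 - t ^ 4) * τ + 1 = 0) :
    rileyPoly t M s = 0 := by
  have e : rileyPoly t M s =
      -((s * (M - t)) ^ 2 - (M ^ 2 - t ^ 2 - 1) * (s * (M - t)) + t ^ 2) := by
    unfold rileyPoly
    grind
  rw [e, hs]
  grind

/-- The value of `M⁴ L (1 - t²)²` in terms of the parameters `t` and `τ`. -/
def detectedNumerator {R : Type} [CommRing R] (t τ : R) : R :=
  (1 + t ^ 4 * τ) ^ 2 + t ^ 4 * τ ^ 2 * (t ^ 4 * τ + t ^ 2) - t ^ 2 * τ ^ 2 * (1 - t ^ 2) ^ 2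

/-- The factor `(1 - t²)² = t²(M - t)²` clears denominators: the Riley condition turns `((M + t -
s)s - 1)(M - t)²` into `σ + t² - (M - t)²` with `σ = s(M - t)`. The right side equals 1 at `t = 0`,
which is the statement that slope 4 has limiting eigenvalue 1. -/
theorem longitudeEigenvalue_eq {R : Type} [CommRing R] {t M s τ : R} (h : t * M = 1)
    (hs : s * (M - t) = t ^ 4 * τ) (hτ : t ^ 6 * τ ^ 2 - (1 - t ^ 2 - t ^ 4) * τ + 1 = 0) :
    M ^ 4 * longitudeEigenvalue t M s * (1 - t ^ 2) ^ 2 = detectedNumerator t τ := by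
  have hQ := rileyPoly_eq_zero h hs hτ
  have e : longitudeEigenvalue t M s * (M - t) ^ 2 = t ^ 2 * (1 + s * (M - t)) ^ 2 +
      M ^ 2 * (s * (M - t)) ^ 2 * (s * (M - t) + t ^ 2 - (M - t) ^ 2) := by
    unfold rileyPoly at hQ
    unfold longitudeEigenvalue
    grind
  have e' : M ^ 4 * longitudeEigenvalue t M s * (1 - t ^ 2) ^ 2 =
      M ^ 2 * (longitudeEigenvalue t M s * (M - t) ^ 2) := by
    rw [show M - t = M * (1 - t ^ 2) by linear_combination t * h]
    ring
  rw [e', e, hs]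
  clear e e' hQ hs hτ
  unfold detectedNumerator
  grind

/-- A vanishing lower left entry of `conjMeridian` makes the representation reducible, which happens
only where `M²` is a root of the Alexander polynomial `x² - 3x + 1`. -/
theorem sq_add_sq_eq_three {R : Type} [CommRing R] {t M s : R} (h : t * M = 1)
    (hQ : rileyPoly t M s = 0) (hr : (M + t - s) * s - 1 = 0) : M ^ 2 + t ^ 2 = 3 := by
  unfold rileyPoly at hQ
  have e : s * (M - t) = M ^ 2 - 2 := by grind
  have e' : (M ^ 2 - 2) ^ 2 - (M ^ 2 - t ^ 2 - 1) * (M ^ 2 - 2) + t ^ 2 = 0 := by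
    rw [← e]
    grind
  grind

/-! ### Irreducible representations near the ideal point -/

/-- The only lines preserved by a diagonal matrix with distinct entries are the coordinate axes, and
nonzero off-diagonal entries of `ρ h` move both of them. -/
theorem isIrreducibleRep_of_diagSL {G : Type} [Group G] (ρ : G →* SL2C) (u : ℂˣ)
    (hu : (u : ℂ) ≠ ((u⁻¹ : ℂˣ) : ℂ)) {g h : G} (hg : ρ g = diagSL ℂ u) (h01 : ρ h 0 1 ≠ 0)
    (h10 : ρ h 1 0 ≠ 0) : IsIrreducibleRep ρ := by
  have hu' := sub_ne_zero.mpr hu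
  have key : ∀ S : Subrepresentation (linearRep ρ), S ≠ ⊥ → S = ⊤ := by
    intro S hS
    have hS' : S.toSubmodule ≠ ⊥ := fun e =>
      hS (Subrepresentation.toSubmodule_injective e)
    have hh : ∀ v ∈ S.toSubmodule, (ρ h : Matrix (Fin 2) (Fin 2) ℂ).mulVec v ∈ S.toSubmodule :=
      fun v hv => S.apply_mem_toSubmodule h hv
    have hd : ∀ v ∈ S.toSubmodule, ![(u : ℂ) * v 0, ((u⁻¹ : ℂˣ) : ℂ) * v 1] ∈ S.toSubmodule := by
      intro v hv
      have := S.apply_mem_toSubmodule g hv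
      convert this using 1
      change _ = (ρ g : Matrix (Fin 2) (Fin 2) ℂ).mulVec v
      rw [hg, coe_diagSL]
      ext i
      fin_cases i <;> simp [Matrix.mulVec, dotProduct]
    have h0 : ∀ v ∈ S.toSubmodule, v 0 ≠ 0 → (![1, 0] : Fin 2 → ℂ) ∈ S.toSubmodule := by
      intro v hv hv0
      -- `ρ g - u⁻¹` kills the second coordinate and scales the first by `u - u⁻¹`.
      have := S.toSubmodule.smul_mem (((u : ℂ) - ((u⁻¹ : ℂˣ) : ℂ)) * v 0)⁻¹
        (S.toSubmodule.sub_mem (hd v hv) (S.toSubmodule.smul_mem ((u⁻¹ : ℂˣ) : ℂ) hv))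
      convert this using 1
      ext i
      fin_cases i
      · simp only [Fin.zero_eta, Fin.isValue, Matrix.cons_val_zero, Pi.smul_apply, Pi.sub_apply,
          smul_eq_mul]
        rw [← sub_mul, inv_mul_cancel₀ (mul_ne_zero hu' hv0)]
      · simp [Matrix.vecHead, Matrix.vecTail]
    have h1 : ∀ v ∈ S.toSubmodule, v 1 ≠ 0 → (![0, 1] : Fin 2 → ℂ) ∈ S.toSubmodule := by
      intro v hv hv1
      have := S.toSubmodule.smul_mem (((u : ℂ) - ((u⁻¹ : ℂˣ) : ℂ)) * v 1)⁻¹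
        (S.toSubmodule.sub_mem (S.toSubmodule.smul_mem (u : ℂ) hv) (hd v hv))
      convert this using 1
      ext i
      fin_cases i
      · simp [Matrix.vecHead]
      · simp only [Fin.mk_one, Fin.isValue, Matrix.cons_val_one, Matrix.cons_val_fin_one,
          Pi.smul_apply, Pi.sub_apply, smul_eq_mul]
        rw [← sub_mul, inv_mul_cancel₀ (mul_ne_zero hu' hv1)]
    have both : (![1, 0] : Fin 2 → ℂ) ∈ S.toSubmodule ∧ (![0, 1] : Fin 2 → ℂ) ∈ S.toSubmodule := by
      obtain ⟨v, hv, hv0⟩ := S.toSubmodule.exists_mem_ne_zero_of_ne_bot hS'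
      by_cases hv0' : v 0 = 0
      · have hv1 : v 1 ≠ 0 := by
          intro hv1
          apply hv0
          ext i
          fin_cases i
          · exact hv0'
          · exact hv1
        have e1 := h1 v hv hv1
        exact ⟨h0 _ (hh _ e1) (by simpa [Matrix.mulVec, dotProduct] using h01), e1⟩
      · have e0 := h0 v hv hv0'
        exact ⟨e0, h1 _ (hh _ e0) (by simpa [Matrix.mulVec, dotProduct] using h10)⟩
    apply Subrepresentation.toSubmodule_injective
    refine (Submodule.eq_top_iff').mpr fun v => ?_
    have := S.toSubmodule.add_mem (S.toSubmodule.smul_mem (v 0) both.1)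
      (S.toSubmodule.smul_mem (v 1) both.2)
    convert this using 1
    ext i
    fin_cases i <;> simp
  have hnt : Nontrivial (Subrepresentation (linearRep ρ)) := by
    refine ⟨⊥, ⊤, fun e => ?_⟩
    have e' : (⊥ : Submodule ℂ (Fin 2 → ℂ)) = ⊤ := congrArg Subrepresentation.toSubmodule e
    exact bot_ne_top e'
  exact { eq_bot_or_eq_top := fun S => or_iff_not_imp_left.mpr (key S) }

/-- At `t = 0` both radicands, the discriminant `Δ` and `U = M⁴Λ`, equal 1, so the principal roots
are continuous there; the factor `ξ` selects the limit. Where `1 - t² = 0` the quotient `U` is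
meaningless, whence the alternative. -/
theorem exists_continuous_branch {n : ℕ} (hn : n ≠ 0) (ξ : ℂ) (hξ : ξ ^ n = 1) :
    ∃ w α : ℂ → ℂ, (∀ t, w t ^ 2 - (1 - t ^ 2 - t ^ 4) * w t + t ^ 6 = 0) ∧
      (∀ t, α t ^ n * (1 - t ^ 2) ^ 2 = detectedNumerator t (w t)⁻¹ ∨ 1 - t ^ 2 = 0) ∧
      Tendsto α (𝓝 0) (𝓝 ξ) := by
  let Δ : ℂ → ℂ := fun t => (1 - t ^ 2 - t ^ 4) ^ 2 - 4 * t ^ 6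
  let w : ℂ → ℂ := fun t => ((1 - t ^ 2 - t ^ 4) + Δ t ^ (((2 : ℕ) : ℂ)⁻¹)) / 2
  let U : ℂ → ℂ := fun t => detectedNumerator t (w t)⁻¹ / (1 - t ^ 2) ^ 2
  have hΔ0 : Δ 0 = 1 := by simp [Δ]
  have hw0 : w 0 = 1 := by simp [w, hΔ0]
  have hU0 : U 0 = 1 := by simp [U, detectedNumerator]
  have hwc : ContinuousAt w 0 := by
    have hΔc : ContinuousAt Δ 0 := by fun_prop
    have : ContinuousAt (fun t => Δ t ^ (((2 : ℕ) : ℂ)⁻¹)) 0 :=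
      hΔc.cpow continuousAt_const (by rw [hΔ0]; exact Complex.one_mem_slitPlane)
    fun_prop
  have hUc : ContinuousAt U 0 := by
    have hi : ContinuousAt (fun t => (w t)⁻¹) 0 := hwc.inv₀ (by rw [hw0]; exact one_ne_zero)
    refine ContinuousAt.div ?_ (by fun_prop) (by simp)
    unfold detectedNumerator
    fun_prop
  have hαc : ContinuousAt (fun t => ξ * U t ^ ((n : ℂ)⁻¹)) 0 :=
    continuousAt_const.mul
      (hUc.cpow continuousAt_const (by rw [hU0]; exact Complex.one_mem_slitPlane))
  refine ⟨w, fun t => ξ * U t ^ ((n : ℂ)⁻¹), fun t => ?_, fun t => ?_, ?_⟩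
  · have := Complex.cpow_nat_inv_pow (Δ t) two_ne_zero
    simp only [w]
    linear_combination this / 4
  · by_cases ht : 1 - t ^ 2 = 0
    · exact Or.inr ht
    · left
      rw [mul_pow, hξ, one_mul, Complex.cpow_nat_inv_pow _ hn]
      exact div_mul_cancel₀ _ (pow_ne_zero 2 ht)
  · have := hαc.tendsto
    rwa [hU0, Complex.one_cpow, mul_one] at this

theorem exists_irreducible_rep {n : ℕ} (hn : n ≠ 0) (i : ℕ) {w α : ℂ}
    (hw : w ^ 2 - (1 - (1 / ((i : ℂ) + 2)) ^ 2 - (1 / ((i : ℂ) + 2)) ^ 4) * w +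
      (1 / ((i : ℂ) + 2)) ^ 6 = 0)
    (hα : α ^ n * (1 - (1 / ((i : ℂ) + 2)) ^ 2) ^ 2 =
      detectedNumerator (1 / ((i : ℂ) + 2)) w⁻¹) :
    ∃ ρ : GluedManifold.Γ n →* SL2C, IsIrreducibleRep ρ ∧
      (ρ (GluedManifold.a n) : Matrix (Fin 2) (Fin 2) ℂ) = !![α, 0; 0, α⁻¹] ∧
      (ρ (GluedManifold.L n) : Matrix (Fin 2) (Fin 2) ℂ) =
        !![(1 / ((i : ℂ) + 2) * α ^ n) ^ n, 0; 0, ((1 / ((i : ℂ) + 2) * α ^ n) ^ n)⁻¹] := by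
  have hM : (i : ℂ) + 2 ≠ 0 := by exact_mod_cast (Nat.succ_ne_zero (i + 1))
  set M : ℂ := (i : ℂ) + 2 with hMdef
  set t : ℂ := 1 / M with ht
  have htM : t * M = 1 := one_div_mul_cancel hM
  have ht0 : t ≠ 0 := one_div_ne_zero hM
  have hMt : M ≠ t := by
    intro e
    rw [← e, hMdef] at htM
    have : (i + 2) * (i + 2) = 1 := by exact_mod_cast htM
    nlinarith
  have ht2 : 1 - t ^ 2 ≠ 0 := fun e => hMt (by linear_combination M * e + t * htM)
  have hw0 : w ≠ 0 := by
    rintro rfl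
    exact pow_ne_zero 6 ht0 (by linear_combination hw)
  have hτ : t ^ 6 * w⁻¹ ^ 2 - (1 - t ^ 2 - t ^ 4) * w⁻¹ + 1 = 0 := by
    field_simp
    linear_combination hw
  have hs : t ^ 4 * w⁻¹ / (M - t) * (M - t) = t ^ 4 * w⁻¹ :=
    div_mul_cancel₀ _ (sub_ne_zero.mpr hMt)
  set s := t ^ 4 * w⁻¹ / (M - t)
  have hQ := rileyPoly_eq_zero htM hs hτ
  have hL : α ^ n = M ^ 4 * longitudeEigenvalue t M s :=
    mul_right_cancel₀ (pow_ne_zero 2 ht2)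
      (hα.trans (longitudeEigenvalue_eq htM hs hτ).symm)
  have hti : M⁻¹ = t := (one_div M).symm
  obtain ⟨ρ, x, z, ⟨g, hg⟩, ⟨h, hh⟩, ha, hb, hx, hz⟩ := exists_rep hn (Units.mk0 M hM)
    (by simpa [hti] using hMt) s α (by simpa [hti] using hQ) (by simpa [hti] using hL)
  refine ⟨ρ, ?_, ?_, ?_⟩
  · refine isIrreducibleRep_of_diagSL ρ (Units.mk0 M hM) (by simpa [hti] using hMt) hg
      (h := h) ?_ ?_
    · rw [hh, coe_conjMeridian]
      simp
    · rw [hh, coe_conjMeridian]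
      intro e
      have e2 := sq_add_sq_eq_three htM hQ (by simpa [hti] using e)
      -- A reducible representation would give `M²(M² - 3) = -1`, impossible for an integer `M = i +
      -- 2 ≥ 2`.
      have e3 : M ^ 4 + 1 = 3 * M ^ 2 := by
        linear_combination M ^ 2 * e2 - (t * M + 1) * htM
      have e4 : (i + 2) ^ 4 + 1 = 3 * (i + 2) ^ 2 := by
        rw [hMdef] at e3
        exact_mod_cast e3
      nlinarith [sq_nonneg i, Nat.zero_le i]
  · rw [ha, coe_diagSL, Units.val_inv_eq_inv_val, hx]
  · rw [hb, coe_diagSL, Units.val_inv_eq_inv_val, hz]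
    simp [hti]

theorem exists_tendsto_reps {n : ℕ} (hn : n ≠ 0) (ξ : ℂ) (hξ : ξ ^ n = 1) :
    ∃ (ρ : ℕ → GluedManifold.Γ n →* SL2C) (A B : ℕ → ℂ),
      (∀ i, IsIrreducibleRep (ρ i)) ∧
      (∀ i, (ρ i (GluedManifold.L n) : Matrix (Fin 2) (Fin 2) ℂ) = !![B i, 0; 0, (B i)⁻¹]) ∧
      (∀ i, (ρ i (GluedManifold.a n) : Matrix (Fin 2) (Fin 2) ℂ) = !![A i, 0; 0, (A i)⁻¹]) ∧
      Tendsto B atTop (𝓝 0) ∧ Tendsto A atTop (𝓝 ξ) := by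
  obtain ⟨w, α, hw, hα, hlim⟩ := exists_continuous_branch hn ξ hξ
  have ht : Tendsto (fun i : ℕ => 1 / ((i : ℂ) + 2)) atTop (𝓝 0) := by
    have := (tendsto_add_atTop_iff_nat 2).mpr (tendsto_one_div_atTop_nhds_zero_nat (𝕜 := ℂ))
    simpa using this
  have hα' : ∀ i : ℕ, α (1 / ((i : ℂ) + 2)) ^ n * (1 - (1 / ((i : ℂ) + 2)) ^ 2) ^ 2 =
      detectedNumerator (1 / ((i : ℂ) + 2)) (w (1 / ((i : ℂ) + 2)))⁻¹ := by
    intro i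
    refine (hα _).resolve_right fun e => ?_
    have hM : (i : ℂ) + 2 ≠ 0 := by exact_mod_cast (Nat.succ_ne_zero (i + 1))
    field_simp at e
    have e' : (i + 2) ^ 2 = 1 := by
      have : ((i : ℂ) + 2) ^ 2 = 1 := by linear_combination e
      exact_mod_cast this
    nlinarith [pow_two (i + 2)]
  choose ρ hirr ha hL using fun i : ℕ => exists_irreducible_rep hn i (hw _) (hα' i)
  refine ⟨ρ, _, _, hirr, hL, ha, ?_, hlim.comp ht⟩
  have h1 := (ht.mul ((hlim.comp ht).pow n)).pow n
  simpa [hn] using h1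

/-! ### Curves of characters -/

/-- The points of an affine variety over `ℂ` separate its regular functions. -/
theorem eq_zero_of_forall_algHom {A : Type} [CommRing A] [IsReduced A] [Algebra ℂ A]
    [Algebra.FiniteType ℂ A] (x : A) (hx : ∀ φ : A →ₐ[ℂ] ℂ, φ x = 0) : x = 0 := by
  have hJ : IsJacobsonRing A := isJacobsonRing_of_finiteType (A := ℂ)
  have hmem : x ∈ (⊥ : Ideal A).jacobson := by
    rw [Ideal.jacobson, Submodule.mem_sInf]
    rintro m ⟨-, hm⟩
    let := Ideal.Quotient.field m
    have hfin : Module.Finite ℂ (A ⧸ m) := finite_of_finite_type_of_isJacobsonRing ℂ (A ⧸ m)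
    have hbij : Function.Bijective (algebraMap ℂ (A ⧸ m)) :=
      -- Nullstellensatz: each residue field is `ℂ`, so every maximal ideal is the kernel of a
      -- point, and the Jacobson property turns membership in all of them into nilpotence.
      IsAlgClosed.algebraMap_bijective_of_isIntegral
    let e : ℂ ≃ₐ[ℂ] (A ⧸ m) := AlgEquiv.ofBijective (Algebra.ofId ℂ (A ⧸ m)) hbij
    have h0 := hx ((e.symm : (A ⧸ m) →ₐ[ℂ] ℂ).comp (Ideal.Quotient.mkₐ ℂ m))
    exact Ideal.Quotient.eq_zero_iff_mem.mp ((map_eq_zero_iff e.symm e.symm.injective).mp h0)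
  rw [← Ideal.radical_eq_jacobson] at hmem
  obtain ⟨k, hk⟩ := hmem
  exact eq_zero_of_pow_eq_zero (show x ^ k = 0 from hk)

/-- Algebraically closed fields are algebraically closed in every extension. -/
theorem mem_range_algebraMap_of_isIntegral {k F : Type} [Field k] [IsAlgClosed k] [Field F]
    [Algebra k F] {x : F} (hx : IsIntegral k x) : x ∈ Set.range (algebraMap k F) := by
  have : Algebra.IsAlgebraic k (IntermediateField.adjoin k {x}) :=
    IntermediateField.isAlgebraic_adjoin_simple hx
  have h := IntermediateField.eq_bot_of_isAlgClosed_of_isAlgebraic (IntermediateField.adjoin k {x})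
  exact IntermediateField.mem_bot.mp (h ▸ IntermediateField.mem_adjoin_simple_self k x)

/-! ### The closure of the specializations of a representation -/

section

variable {G A : Type} [Group G] [CommRing A] [Algebra ℂ A]

/-- The character of the specialization of `ρ` at a point. -/
def specializedCharacter (ρ : G →* Matrix.SpecialLinearGroup (Fin 2) A) (φ : A →ₐ[ℂ] ℂ) :
    CharacterVariety G :=
  ⟨sl2Character ((Matrix.SpecialLinearGroup.map (φ : A →+* ℂ)).comp ρ), _, rfl⟩

theorem traceFunction_specializedCharacter (ρ : G →* Matrix.SpecialLinearGroup (Fin 2) A)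
    (φ : A →ₐ[ℂ] ℂ) (g : G) : traceFunction g (specializedCharacter ρ φ) =
      φ (ρ g : Matrix (Fin 2) (Fin 2) A).trace := by
  simp [traceFunction, specializedCharacter, sl2Character, Matrix.trace, Fin.sum_univ_two]

/-- The regular functions that vanish at all specializations of `ρ`. -/
def vanishingFunctions (ρ : G →* Matrix.SpecialLinearGroup (Fin 2) A) :
    Set (CharacterVariety G → ℂ) :=
  {f | f ∈ regularFunctions G ∧ ∀ φ, f (specializedCharacter ρ φ) = 0}

/-- The Zariski closure of the set of specializations of `ρ`. -/
def specializationClosure (ρ : G →* Matrix.SpecialLinearGroup (Fin 2) A) :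
    Set (CharacterVariety G) :=
  {χ | ∀ f ∈ vanishingFunctions ρ, f χ = 0}

theorem specializedCharacter_mem (ρ : G →* Matrix.SpecialLinearGroup (Fin 2) A)
    (φ : A →ₐ[ℂ] ℂ) : specializedCharacter ρ φ ∈ specializationClosure ρ :=
  fun _ hf => hf.2 φ

/-- Pull back of functions to the set of points of `A`. -/
def pullback (ρ : G →* Matrix.SpecialLinearGroup (Fin 2) A) :
    (specializationClosure ρ → ℂ) →ₐ[ℂ] ((A →ₐ[ℂ] ℂ) → ℂ) where
  toFun f := fun φ => f ⟨specializedCharacter ρ φ, specializedCharacter_mem ρ φ⟩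
  map_one' := rfl
  map_mul' _ _ := rfl
  map_zero' := rfl
  map_add' _ _ := rfl
  commutes' _ := rfl

/-- The evaluation of elements of `A` at points. -/
def evaluation (A : Type) [CommRing A] [Algebra ℂ A] : A →ₐ[ℂ] ((A →ₐ[ℂ] ℂ) → ℂ) :=
  AlgHom.pi fun φ => φ

theorem pullback_mem_range (ρ : G →* Matrix.SpecialLinearGroup (Fin 2) A)
    (x : coordinateRing (specializationClosure ρ)) :
    pullback ρ x ∈ (evaluation A).range := by
  have h : (coordinateRing (specializationClosure ρ)).map (pullback ρ) ≤ (evaluation A).range := by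
    rw [coordinateRing, regularFunctions, Subalgebra.map_map, AlgHom.map_adjoin]
    refine Algebra.adjoin_le ?_
    rintro _ ⟨_, ⟨g, rfl⟩, rfl⟩
    refine ⟨(ρ g : Matrix (Fin 2) (Fin 2) A).trace, ?_⟩
    ext φ
    exact (traceFunction_specializedCharacter ρ φ g).symm
  exact h ⟨x, x.2, rfl⟩

/-- A regular function restricted to the specializations is evaluation of a polynomial in the traces
of `ρ`, hence of an element of `A`; this element is unique because points separate elements of `A`.
-/
theorem exists_embedding [IsReduced A] [Algebra.FiniteType ℂ A]
    (ρ : G →* Matrix.SpecialLinearGroup (Fin 2) A) :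
    ∃ j : coordinateRing (specializationClosure ρ) →ₐ[ℂ] A, Function.Injective j ∧
      ∀ (g : G) (x : coordinateRing (specializationClosure ρ)),
        (x : specializationClosure ρ → ℂ) = restrictTo _ (traceFunction g) →
          j x = (ρ g : Matrix (Fin 2) (Fin 2) A).trace := by
  have hev : Function.Injective (evaluation A) := by
    refine (injective_iff_map_eq_zero _).mpr fun x hx => eq_zero_of_forall_algHom x fun φ => ?_
    exact congrFun hx φ
  let θ : coordinateRing (specializationClosure ρ) →ₐ[ℂ] (evaluation A).range :=
    ((pullback ρ).comp (coordinateRing _).val).codRestrict _ (pullback_mem_range ρ)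
  let e := AlgEquiv.ofInjective (evaluation A) hev
  have hj : ∀ x, evaluation A (e.symm (θ x)) = pullback ρ x := by
    intro x
    exact congrArg Subtype.val (e.apply_symm_apply (θ x))
  refine ⟨(e.symm : (evaluation A).range →ₐ[ℂ] A).comp θ, ?_, ?_⟩
  · refine (injective_iff_map_eq_zero _).mpr fun x hx => ?_
    have h0 : pullback ρ x = 0 := by
      rw [← hj x]
      exact (congrArg _ hx).trans (map_zero _)
    obtain ⟨f, hf, hfx⟩ := x.2
    -- Injectivity: a regular function that is zero at all specializations is one of the equations
    -- defining the closure.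
    have hfv : f ∈ vanishingFunctions ρ := by
      refine ⟨hf, fun φ => ?_⟩
      have := congrFun h0 φ
      rw [← hfx] at this
      exact this
    ext χ
    rw [← hfx]
    exact χ.2 f hfv
  · intro g x hx
    apply hev
    refine (hj x).trans ?_
    rw [hx]
    ext φ
    exact traceFunction_specializedCharacter ρ φ g

end

/-- A representation over a finitely generated subalgebra of a field of transcendence degree one,
with a non-constant trace, gives a curve of characters, the function field of which embeds in the
given field. -/
theorem exists_characterCurve {G F : Type} [Group G] [Field F] [Algebra ℂ F]
    (hF : Algebra.trdeg ℂ F ≤ 1) (A : Subalgebra ℂ F) [Algebra.FiniteType ℂ A]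
    (ρ : G →* Matrix.SpecialLinearGroup (Fin 2) A)
    (hρ : ∃ g, ((ρ g : Matrix (Fin 2) (Fin 2) A).trace : F) ∉ Set.range (algebraMap ℂ F)) :
    ∃ (X : CharacterCurve G) (j : X.FunctionField →ₐ[ℂ] F),
      ∀ g, j (X.I g) = (ρ g : Matrix (Fin 2) (Fin 2) A).trace := by
  obtain ⟨j₀, hj₀, htr⟩ := exists_embedding ρ
  let j₁ := A.val.comp j₀
  have hj₁ : Function.Injective j₁ := Subtype.val_injective.comp hj₀
  have hdom : IsDomain (coordinateRing (specializationClosure ρ)) :=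
    hj₁.isDomain j₁.toRingHom
  have htrdeg : Algebra.trdeg ℂ (coordinateRing (specializationClosure ρ)) = 1 := by
    refine le_antisymm ((trdeg_le_of_injective j₁ hj₁).trans hF) ?_
    -- In transcendence degree zero every trace would be algebraic over `ℂ`, hence constant in `F`.
    rw [Cardinal.one_le_iff_ne_zero]
    intro h0
    have halg := trdeg_eq_zero_iff.mp h0
    obtain ⟨g, hg⟩ := hρ
    let x : coordinateRing (specializationClosure ρ) :=
      ⟨restrictTo _ (traceFunction g), traceFunction g,
        Algebra.subset_adjoin (Set.mem_range_self g), rfl⟩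
    have hx : IsIntegral ℂ (j₁ x) := ((halg.isAlgebraic x).isIntegral).map j₁
    obtain ⟨c, hc⟩ := mem_range_algebraMap_of_isIntegral hx
    refine hg ⟨c, hc.trans ?_⟩
    exact congrArg Subtype.val (htr g x rfl)
  let X : CharacterCurve G :=
    { carrier := specializationClosure ρ
      isZariskiClosed := ⟨vanishingFunctions ρ, fun f hf => hf.1, rfl⟩
      isDomain := hdom
      trdeg_eq_one := htrdeg }
  refine ⟨X, IsFractionRing.liftAlgHom (A := coordinateRing X.carrier) (g := j₁) hj₁, fun g => ?_⟩
  rw [CharacterCurve.I, IsFractionRing.liftAlgHom_apply, IsFractionRing.lift_algebraMap]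
  exact congrArg Subtype.val (htr g (X.traceElt g) rfl)

/-! ### The ideal point -/

theorem trdeg_algebraicClosure_ratFunc :
    Algebra.trdeg ℂ (AlgebraicClosure (RatFunc ℂ)) = 1 := by
  have : Algebra.IsAlgebraic (Polynomial ℂ) (RatFunc ℂ) :=
    IsLocalization.isAlgebraic _ (nonZeroDivisors _)
  rw [← trdeg_add_eq ℂ (RatFunc ℂ), ← trdeg_add_eq ℂ (Polynomial ℂ) (A := RatFunc ℂ),
    trdeg_eq_zero (R := RatFunc ℂ), trdeg_eq_zero (R := Polynomial ℂ), add_zero, add_zero,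
    Polynomial.trdeg_of_isDomain]

/-- Every non-constant element of an extension of `ℂ` has a pole at some place. -/
theorem exists_valuationSubring_notMem {F : Type} [Field F] [Algebra ℂ F] {x : F}
    (hx : x ∉ Set.range (algebraMap ℂ F)) :
    ∃ V : ValuationSubring F, (∀ c, algebraMap ℂ F c ∈ V) ∧ x ∉ V := by
  -- An integrally closed subring is the intersection of the valuation rings containing it, so some
  -- valuation ring over `ℂ` omits `x`.
  have : IsIntegrallyClosedIn (algebraMap ℂ F).range F := by
    rw [Subring.isIntegrallyClosedIn_iff]
    intro y hy
    obtain ⟨c, hc⟩ := mem_range_algebraMap_of_isIntegral (k := ℂ) (x := y) <| by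
      obtain ⟨p, hp, hpy⟩ := hy
      obtain ⟨q, hq, -, hqm⟩ := Polynomial.lifts_and_natDegree_eq_and_monic
        (f := (algebraMap ℂ F).rangeRestrict)
        ((Polynomial.mem_lifts p).mpr
          (Polynomial.map_surjective _ (algebraMap ℂ F).rangeRestrict_surjective p)) hp
      refine ⟨q, hqm, ?_⟩
      rw [← hq, Polynomial.eval₂_map] at hpy
      exact hpy
    exact ⟨c, hc⟩
  obtain ⟨V, hV, hxV⟩ := Subring.exists_le_valuationSubring_of_isIntegrallyClosedIn
    (R := (algebraMap ℂ F).range) (x := x) hx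
  exact ⟨V, fun c => hV ⟨c, rfl⟩, hxV⟩

/-- The residue field of a place need not be identified with `ℂ`; this puts its roots of unity in
the image of `ℂ`. -/
theorem exists_eq_root_of_pow_eq_one {k : Type} [Field k] (ι : ℂ →+* k) {n : ℕ} (hn : n ≠ 0)
    {x : k} (hx : x ^ n = 1) : ∃ ζ : ℂ, ζ ^ n = 1 ∧ x = ι ζ := by
  have h := Polynomial.X_pow_sub_one_eq_prod (Nat.pos_of_ne_zero hn) (Complex.isPrimitiveRoot_exp n hn)
  have h' := congrArg (Polynomial.eval₂ ι x) h
  rw [Polynomial.eval₂_finsetProd] at h'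
  simp only [Polynomial.eval₂_sub, Polynomial.eval₂_X_pow, Polynomial.eval₂_one,
    Polynomial.eval₂_X, Polynomial.eval₂_C, hx, sub_self] at h'
  obtain ⟨ζ, hζ, h0⟩ := Finset.prod_eq_zero_iff.mp h'.symm
  exact ⟨ζ, (Polynomial.mem_nthRootsFinset (Nat.pos_of_ne_zero hn) 1).mp hζ, sub_eq_zero.mp h0⟩

/-- The branch of the parametrization with `α` specializing to `ξ` at a place where `t` vanishes. -/
theorem exists_branch_at_place {F : Type} [Field F] [Algebra ℂ F] [IsAlgClosed F]
    (V : ValuationSubring F) (hV : ∀ c, algebraMap ℂ F c ∈ V) {t : F} (ht : t ∈ V.nonunits)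
    {n : ℕ} (hn : n ≠ 0) (ξ : ℂ) (hξ : ξ ^ n = 1) :
    ∃ w α : F, w ^ 2 - (1 - t ^ 2 - t ^ 4) * w + t ^ 6 = 0 ∧
      α ^ n * (1 - t ^ 2) ^ 2 = detectedNumerator t w⁻¹ ∧
      α ∈ V ∧ α⁻¹ ∈ V ∧ α - algebraMap ℂ F ξ ∈ V.nonunits := by
  have hchar : CharZero F := charZero_of_injective_algebraMap (algebraMap ℂ F).injective
  have hint : ∀ x : F, IsIntegral V x → ∃ y : V, (y : F) = x := fun x hx =>
    IsIntegrallyClosed.isIntegral_iff.mp hx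
  let r : V →+* IsLocalRing.ResidueField V := IsLocalRing.residue V
  have hunit : ∀ x : V, r x ≠ 0 → ∃ y : V, x * y = 1 := fun x hx =>
    isUnit_iff_exists_inv.mp ((IsLocalRing.residue_ne_zero_iff_isUnit x).mp hx)
  let c : ℂ →+* V := (algebraMap ℂ F).codRestrict V.toSubring hV
  have hc : ∀ z, (c z : F) = algebraMap ℂ F z := fun z => rfl
  obtain ⟨t', rfl⟩ : ∃ y : V, (y : F) = t := ⟨⟨t, V.nonunits_subset ht⟩, rfl⟩
  have hrt : r t' = 0 := (IsLocalRing.residue_eq_zero_iff _).mpr (V.coe_mem_nonunits_iff.mp ht)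
  obtain ⟨w, hw, hrw⟩ : ∃ w : V, w ^ 2 - (1 - t' ^ 2 - t' ^ 4) * w + t' ^ 6 = 0 ∧ r w = 1 := by
    obtain ⟨δ, hδ⟩ := IsAlgClosed.exists_pow_nat_eq
      ((1 - (t' : F) ^ 2 - t' ^ 4) ^ 2 - 4 * t' ^ 6) two_pos
    have hx : (((1 - (t' : F) ^ 2 - t' ^ 4) + δ) / 2) ^ 2 - (1 - (t' : F) ^ 2 - t' ^ 4) *
        (((1 - (t' : F) ^ 2 - t' ^ 4) + δ) / 2) + t' ^ 6 = 0 := by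
      linear_combination hδ / 4
    obtain ⟨w, hw⟩ := hint (((1 - (t' : F) ^ 2 - t' ^ 4) + δ) / 2) (by
      refine ⟨Polynomial.X ^ 2 - Polynomial.C (1 - t' ^ 2 - t' ^ 4) * Polynomial.X +
        Polynomial.C (t' ^ 6), by monicity!, ?_⟩
      simpa using hx)
    rw [← hw] at hx
    have hw' : w ^ 2 - (1 - t' ^ 2 - t' ^ 4) * w + t' ^ 6 = 0 := by
      apply Subtype.val_injective
      push_cast
      exact hx
    have hr := congrArg r hw'
    simp only [map_add, map_sub, map_mul, map_pow, map_one, hrt, map_zero] at hr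
    -- The residues of the two roots are 0 and 1. If the root found reduces to 0, the other one,
    -- given by the sum of the roots, reduces to 1.
    rcases mul_eq_zero.mp (show r w * (r w - 1) = 0 by linear_combination hr) with h | h
    · refine ⟨1 - t' ^ 2 - t' ^ 4 - w, by linear_combination hw', ?_⟩
      simp [hrt, h]
    · exact ⟨w, hw', sub_eq_zero.mp h⟩
  obtain ⟨τ, hτ⟩ := hunit w (by rw [hrw]; exact one_ne_zero)
  have hrτ : r τ = 1 := by simpa [hrw] using congrArg r hτ
  obtain ⟨e, he⟩ := hunit (1 - t' ^ 2) (by simp [hrt])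
  have hre : r e = 1 := by simpa [hrt] using congrArg r he
  obtain ⟨α₁, hα₁⟩ := IsAlgClosed.exists_pow_nat_eq
    ((detectedNumerator t' τ * e ^ 2 : V) : F) (Nat.pos_of_ne_zero hn)
  obtain ⟨α₀, rfl⟩ := hint α₁ (IsIntegral.of_pow (Nat.pos_of_ne_zero hn)
    (by
      rw [hα₁]
      exact isIntegral_algebraMap (R := V) (A := F) (x := detectedNumerator t' τ * e ^ 2)))
  have hα₀ : α₀ ^ n = detectedNumerator t' τ * e ^ 2 := by
    apply Subtype.val_injective
    rw [← hα₁]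
    push_cast
    rfl
  obtain ⟨ζ, hζ, hrζ⟩ := exists_eq_root_of_pow_eq_one (r.comp c) hn (x := r α₀) (by
    rw [← map_pow, hα₀]
    simp [detectedNumerator, hrt, hre])
  have hζ0 : ζ ≠ 0 := by
    rintro rfl
    simp [hn] at hζ
  have hξ0 : ξ ≠ 0 := by
    rintro rfl
    simp [hn] at hξ
  -- An arbitrary `n`-th root `α₀` reduces to some root of unity `ζ`; multiplying by the constant
  -- `ξζ⁻¹` keeps the `n`-th power and changes the residue to `ξ`.
  have hrα : r (c (ξ * ζ⁻¹) * α₀) = r (c ξ) := by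
    rw [map_mul, hrζ, RingHom.comp_apply, ← map_mul, ← map_mul, inv_mul_cancel_right₀ hζ0]
  obtain ⟨β, hβ⟩ := hunit (c (ξ * ζ⁻¹) * α₀) (by
    rw [hrα]
    exact (map_ne_zero (r.comp c)).mpr hξ0)
  have hαn : (c (ξ * ζ⁻¹) * α₀) ^ n * (1 - t' ^ 2) ^ 2 = detectedNumerator t' τ := by
    rw [mul_pow, ← map_pow, mul_pow, inv_pow, hξ, hζ, inv_one, one_mul, map_one, one_mul, hα₀]
    linear_combination detectedNumerator t' τ * (e * (1 - t' ^ 2) + 1) * he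
  have hτ' : ((w : F))⁻¹ = τ :=
    (eq_inv_of_mul_eq_one_right (by exact_mod_cast congrArg Subtype.val hτ)).symm
  have hβ' : ((c (ξ * ζ⁻¹) * α₀ : V) : F)⁻¹ = β :=
    (eq_inv_of_mul_eq_one_right (by exact_mod_cast congrArg Subtype.val hβ)).symm
  refine ⟨w, (c (ξ * ζ⁻¹) * α₀ : V), ?_, ?_, Subtype.coe_prop _, ?_, ?_⟩
  · exact_mod_cast congrArg Subtype.val hw
  · rw [hτ']
    have := congrArg Subtype.val hαn
    unfold detectedNumerator at this ⊢
    push_cast at this ⊢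
    exact this
  · rw [hβ']
    exact β.2
  · rw [← hc, show ((c (ξ * ζ⁻¹) * α₀ : V) : F) - (c ξ : F) =
      ((c (ξ * ζ⁻¹) * α₀ - c ξ : V) : F) from rfl, V.coe_mem_nonunits_iff,
      ← IsLocalRing.residue_eq_zero_iff]
    exact (map_sub r _ _).trans (sub_eq_zero.mpr hrα)

theorem trace_diagSL {R : Type} [CommRing R] (u : Rˣ) :
    (diagSL R u : Matrix (Fin 2) (Fin 2) R).trace = u + ((u⁻¹ : Rˣ) : R) := by
  rw [coe_diagSL, Matrix.trace_fin_two_of]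

/-- If the sum were in `V`, subtracting `z` would put `z⁻¹` there too; so the trace of a diagonal
matrix with eigenvalue `z` has a pole. -/
theorem add_inv_notMem {F : Type} [Field F] (V : ValuationSubring F) {z : F} (hz : z ∈ V.nonunits)
    (hz0 : z ≠ 0) : z + z⁻¹ ∉ V := fun h =>
  (V.mem_nonunits_iff_or.mp hz).resolve_left hz0 <| by
    have := V.sub_mem h (V.nonunits_subset hz)
    rwa [add_sub_cancel_left] at this

theorem mul_mem_nonunits {F : Type} [Field F] (V : ValuationSubring F) {x z : F}
    (hx : x ∈ V.nonunits) (hz : z ∈ V) : x * z ∈ V.nonunits := by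
  rw [V.mem_nonunits_iff] at hx ⊢
  rw [map_mul]
  exact mul_lt_one_of_lt_of_le hx ((V.valuation_le_one_iff z).mpr hz)

/-- Representations over a field with a place, with prescribed behaviour at the place. -/
theorem exists_rep_over_subalgebra {F : Type} [Field F] [Algebra ℂ F] [IsAlgClosed F]
    (V : ValuationSubring F) (hV : ∀ c, algebraMap ℂ F c ∈ V) {t : F} (ht : t ∈ V.nonunits)
    (ht0 : t ≠ 0) {n : ℕ} (hn : n ≠ 0) (ξ : ℂ) (hξ : ξ ^ n = 1) :
    ∃ (A : Subalgebra ℂ F) (_ : Algebra.FiniteType ℂ A)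
      (ρ : GluedManifold.Γ n →* Matrix.SpecialLinearGroup (Fin 2) A) (x z : F),
      ((ρ (GluedManifold.a n) : Matrix (Fin 2) (Fin 2) A).trace : F) = x + x⁻¹ ∧
      ((ρ (GluedManifold.L n) : Matrix (Fin 2) (Fin 2) A).trace : F) = z + z⁻¹ ∧
      x⁻¹ ∈ V ∧ x ≠ 0 ∧ x - algebraMap ℂ F ξ ∈ V.nonunits ∧ z ∈ V.nonunits ∧ z ≠ 0 := by
  obtain ⟨w, α, hw, hα, hαV, hαV', hαξ⟩ := exists_branch_at_place V hV ht hn ξ hξ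
  have hMV : t⁻¹ ∉ V := (V.mem_nonunits_iff_or.mp ht).resolve_left ht0
  set M := t⁻¹ with hMdef
  have htM : t * M = 1 := mul_inv_cancel₀ ht0
  have hMt : M ≠ t := fun e => hMV (e ▸ V.nonunits_subset ht)
  have ht2 : 1 - t ^ 2 ≠ 0 := fun e => hMt (by linear_combination M * e + t * htM)
  have hw0 : w ≠ 0 := by
    rintro rfl
    exact pow_ne_zero 6 ht0 (by linear_combination hw)
  have hτ : t ^ 6 * w⁻¹ ^ 2 - (1 - t ^ 2 - t ^ 4) * w⁻¹ + 1 = 0 := by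
    field_simp
    linear_combination hw
  have hs : t ^ 4 * w⁻¹ / (M - t) * (M - t) = t ^ 4 * w⁻¹ :=
    div_mul_cancel₀ _ (sub_ne_zero.mpr hMt)
  set s := t ^ 4 * w⁻¹ / (M - t)
  have hQ := rileyPoly_eq_zero htM hs hτ
  have hL : α ^ n = M ^ 4 * longitudeEigenvalue t M s :=
    mul_right_cancel₀ (pow_ne_zero 2 ht2)
      (hα.trans (longitudeEigenvalue_eq htM hs hτ).symm)
  -- These generators make `M` a unit of `A` and contain all parameters of the representation;
  -- finite generation is needed for the Nullstellensatz.
  let A : Subalgebra ℂ F := Algebra.adjoin ℂ {t, M, s, α}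
  have hA : Algebra.FiniteType ℂ A :=
    A.fg_iff_finiteType.mp (Subalgebra.fg_def.mpr ⟨_, Set.toFinite _, rfl⟩)
  have hmem : ∀ y ∈ ({t, M, s, α} : Set F), y ∈ A := fun y hy => Algebra.subset_adjoin hy
  let t' : A := ⟨t, hmem t (by simp)⟩
  let M' : A := ⟨M, hmem M (by simp)⟩
  let s' : A := ⟨s, hmem s (by simp)⟩
  let α' : A := ⟨α, hmem α (by simp)⟩
  let u : Aˣ := ⟨M', t', Subtype.ext ((mul_comm M t).trans htM), Subtype.ext htM⟩
  obtain ⟨ρ, x, z, -, -, ha, hb, hx, hz⟩ := exists_rep hn u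
    (fun e => hMt (congrArg Subtype.val e)) s' α' (Subtype.ext hQ) (Subtype.ext hL)
  have hinv : ∀ y : Aˣ, (((y⁻¹ : Aˣ) : A) : F) = ((y : A) : F)⁻¹ := fun y =>
    eq_inv_of_mul_eq_one_right (congrArg Subtype.val y.mul_inv)
  have hne : ∀ y : Aˣ, ((y : A) : F) ≠ 0 := fun y hy =>
    y.ne_zero (Subtype.ext hy)
  have hxα : ((x : A) : F) = α := congrArg Subtype.val hx
  have hzt : ((z : A) : F) = (t * α ^ n) ^ n := congrArg Subtype.val hz
  refine ⟨A, hA, ρ, (x : A), (z : A), ?_, ?_, ?_, hne x, ?_, ?_, hne z⟩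
  · rw [ha, trace_diagSL, ← hinv]
    rfl
  · rw [hb, trace_diagSL, ← hinv]
    rfl
  · rwa [hxα]
  · rwa [hxα]
  · obtain ⟨k, rfl⟩ := Nat.exists_eq_succ_of_ne_zero hn
    have h1 := mul_mem_nonunits V ht (pow_mem hαV (k + 1))
    -- One factor `tαⁿ` in the maximal ideal suffices, and `n ≠ 0` supplies it.
    rw [hzt, pow_succ']
    exact mul_mem_nonunits V h1 (pow_mem (V.nonunits_subset h1) k)

theorem exists_idealPoint {n : ℕ} (hn : n ≠ 0) (ξ : ℂ) (hξ : ξ ^ n = 1) :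
    ∃ (X : CharacterCurve (GluedManifold.Γ n)) (x : X.IdealPoint),
      x.AppearsAtSlope (GluedManifold.peripheral n) (GluedManifold.a n) ξ := by
  let F := AlgebraicClosure (RatFunc ℂ)
  have hF : Algebra.trdeg ℂ F = 1 := trdeg_algebraicClosure_ratFunc
  obtain ⟨M, hM⟩ : ∃ M : F, M ∉ Set.range (algebraMap ℂ F) := by
    by_contra! h
    have : Algebra.IsAlgebraic ℂ F := ⟨fun y => by
      obtain ⟨c, rfl⟩ := h y
      exact isAlgebraic_algebraMap c⟩
    rw [trdeg_eq_zero] at hF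
    exact zero_ne_one hF
  obtain ⟨V, hV, hMV⟩ := exists_valuationSubring_notMem hM
  have hM0 : M ≠ 0 := fun e => hMV (e ▸ V.zero_mem)
  obtain ⟨A, hA, ρ, α, z, ha, hL, hα, hα0, hαξ, hz, hz0⟩ := exists_rep_over_subalgebra V hV
    (V.inv_mem_nonunits_iff.mpr (Or.inr hMV)) (inv_ne_zero hM0) hn ξ hξ
  have hpole := add_inv_notMem V hz hz0
  obtain ⟨X, j, hj⟩ := exists_characterCurve hF.le A ρ
    ⟨GluedManifold.L n, by
      rw [hL]
      rintro ⟨c, hc⟩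
      exact hpole (hc ▸ hV c)⟩
  have hpole' : j (X.I (GluedManifold.L n)) ∉ V := by rwa [hj, hL]
  -- The place is the restriction of `V` to the function field; the pole of the trace of `𝓛` makes
  -- it ideal.
  let x : X.IdealPoint :=
    { valuationRing := V.comap (j : X.FunctionField →+* F)
      constants_mem := fun c => by
        rw [ValuationSubring.mem_comap, AlgHom.coe_toRingHom, j.commutes]
        exact hV c
      exists_regular_notMem := ⟨X.traceElt (GluedManifold.L n), hpole'⟩ }
  have hξ0 : ξ ≠ 0 := by
    rintro rfl
    simp [hn] at hξ
  refine ⟨X, x, ⟨GluedManifold.L n, ?_⟩, ⟨GluedManifold.L n, ?_, hpole'⟩, ?_⟩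
  · rw [GluedManifold.peripheral, Set.pair_comm]
  · exact Subgroup.subset_closure (by simp)
  · have hval : j (X.I (GluedManifold.a n) - algebraMap ℂ X.FunctionField (ξ + ξ⁻¹)) =
        (α - algebraMap ℂ F ξ) * (1 - α⁻¹ * algebraMap ℂ F ξ⁻¹) := by
      have h0 : algebraMap ℂ F ξ ≠ 0 := (map_ne_zero _).mpr hξ0
      rw [map_sub, j.commutes, hj, ha, map_add, map_inv₀ (algebraMap ℂ F)]
      linear_combination (algebraMap ℂ F ξ)⁻¹ * mul_inv_cancel₀ hα0 - α⁻¹ * mul_inv_cancel₀ h0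
    have hmem : j (X.I (GluedManifold.a n) - algebraMap ℂ X.FunctionField (ξ + ξ⁻¹)) ∈
        V.nonunits := by
      rw [hval]
      exact mul_mem_nonunits V hαξ (sub_mem V.one_mem (mul_mem hα (hV _)))
    change x.valuationRing.valuation _ < 1
    rw [← ValuationSubring.mem_nonunits_iff, ValuationSubring.mem_nonunits_iff_or]
    rw [ValuationSubring.mem_nonunits_iff_or, map_eq_zero_iff j j.injective, ← map_inv₀] at hmem
    exact hmem

theorem theorem4p1 (n : ℕ) (hn : 0 < n) (ξ : ℂ) (hξ : ξ ^ n = 1) :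
    (∃ (ρ : ℕ → GluedManifold.Γ n →* SL2C) (A B : ℕ → ℂ),
      (∀ i, IsIrreducibleRep (ρ i)) ∧
      (∀ i, (ρ i (GluedManifold.L n) : Matrix (Fin 2) (Fin 2) ℂ) = !![B i, 0; 0, (B i)⁻¹]) ∧
      (∀ i, (ρ i (GluedManifold.a n) : Matrix (Fin 2) (Fin 2) ℂ) = !![A i, 0; 0, (A i)⁻¹]) ∧
      Tendsto B atTop (𝓝 0) ∧ Tendsto A atTop (𝓝 ξ)) ∧
    ∃ (X : CharacterCurve (GluedManifold.Γ n)) (x : X.IdealPoint),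
      x.AppearsAtSlope (GluedManifold.peripheral n) (GluedManifold.a n) ξ := by
  exact ⟨exists_tendsto_reps hn.ne' ξ hξ, exists_idealPoint hn.ne' ξ hξ⟩
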